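/- An oriented graph is a finite digraph without loops and without pairs of opposite arcs; it is triangle-free if its underlying undirected graph contains no triangle. A set of vertices of a digraph $D$ is acyclic if it induces a subdigraph without directed cycles. The acyclic number $\vec\alpha(D)$ is the maximum size of an acyclic set in $D$, and the dichromatic number $\vec\chi(D)$ is the least $k$ such that $V(D)$ can be partitioned into $k$ (possibly empty) acyclic sets. Let $\vec a(n)$ be the minimum of $\vec\alpha(D)$, and $\vec t(n)$ the maximum of $\vec\chi(D)$, over all oriented triangle-free graphs $D$ of order $n$. Let $\log$ denote the natural logarithm. **Theorem.** There is an integer $n_0$ such that for every $n\ge n_0$ there exists an oriented triangle-free graph $D$ of order $n$ with $$\vec\alpha(D)\le \tfrac{107}{8}\sqrt n\,\log n .$$ Consequently, for every $n\ge n_0$, $$\vec a(n)\le \tfrac{107}{8}\sqrt n\,\log n\qquad\text{and}\qquad \vec t(n)\ge \tfrac{8}{107}\,\frac{\sqrt n}{\log n}.$$ -/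

import Mathlib

open Filter

namespace Digraph

/-- An oriented graph: no two opposite arcs between vertices (in particular, no loops). -/
def IsOriented {V : Type*} (D : Digraph V) : Prop :=
  ∀ u v, D.Adj u v → ¬ D.Adj v u

/-- The underlying undirected graph has no triangle. -/
def IsTriangleFree {V : Type*} (D : Digraph V) : Prop :=
  D.toSimpleGraphInclusive.CliqueFree 3

/-- The subdigraph induced by a set of vertices. -/
def induced {V : Type*} (D : Digraph V) (S : Set V) : Digraph S where
  Adj u v := D.Adj u v

/-- A digraph is acyclic if no nontrivial directed walk leads from a vertex back to itself
(equivalently, if it has no directed cycle). -/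
def IsAcyclic {V : Type*} (D : Digraph V) : Prop :=
  ∀ v, ¬ Relation.TransGen D.Adj v v

/-- A set of vertices is acyclic if it induces an acyclic subdigraph. -/
def IsAcyclicSet {V : Type*} (D : Digraph V) (S : Set V) : Prop :=
  (D.induced S).IsAcyclic

/-- The acyclic number: the maximum size of an acyclic set. -/
noncomputable def acyclicNumber {V : Type*} [Fintype V] (D : Digraph V) : ℕ :=
  sSup {k : ℕ | ∃ S : Finset V, D.IsAcyclicSet (S : Set V) ∧ S.card = k}

/-- There is a partition of the vertices into `k` (possibly empty) colour classes, each of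
which is acyclic. -/
def IsDicolourable {V : Type*} (D : Digraph V) (k : ℕ) : Prop :=
  ∃ φ : V → Fin k, ∀ i, D.IsAcyclicSet {v | φ v = i}

/-- The dichromatic number: the least `k` such that the digraph is `k`-dicolourable. -/
noncomputable def dichromaticNumber {V : Type*} [Fintype V] (D : Digraph V) : ℕ :=
  sInf {k : ℕ | D.IsDicolourable k}

end Digraph

/-- The minimum acyclic number of an oriented triangle-free graph of order `n`. -/
noncomputable def minAcyclicNumber (n : ℕ) : ℕ :=
  sInf {k : ℕ | ∃ D : Digraph (Fin n),
    D.IsOriented ∧ D.IsTriangleFree ∧ D.acyclicNumber = k}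

/-- The maximum dichromatic number of an oriented triangle-free graph of order `n`. -/
noncomputable def maxDichromaticNumber (n : ℕ) : ℕ :=
  sSup {k : ℕ | ∃ D : Digraph (Fin n),
    D.IsOriented ∧ D.IsTriangleFree ∧ D.dichromaticNumber = k}

namespace Digraph

/-- The acyclic number is a maximum. -/
theorem acyclicNumber_isGreatest {V : Type*} [Fintype V] (D : Digraph V) :
    IsGreatest {k : ℕ | ∃ S : Finset V, D.IsAcyclicSet (S : Set V) ∧ S.card = k}
      D.acyclicNumber := by
  have hb : BddAbove {k : ℕ | ∃ S : Finset V, D.IsAcyclicSet (S : Set V) ∧ S.card = k} := by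
    refine ⟨Fintype.card V, ?_⟩
    rintro k ⟨S, -, rfl⟩
    exact S.card_le_univ
  refine ⟨Nat.sSup_mem ⟨0, ∅, ?_, rfl⟩ hb, fun k hk => le_csSup hb hk⟩
  rintro ⟨v, hv⟩
  simp at hv

/-- On oriented graphs (where single vertices are acyclic) the dichromatic number is a minimum. -/
theorem dichromaticNumber_isLeast {V : Type*} [Fintype V] (D : Digraph V) (hD : D.IsOriented) :
    IsLeast {k : ℕ | D.IsDicolourable k} D.dichromaticNumber := by
  refine ⟨Nat.sInf_mem ⟨Fintype.card V, Fintype.equivFin V, fun i => ?_⟩,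
    fun k hk => Nat.sInf_le hk⟩
  rintro ⟨v, hv⟩ h
  have key : ∀ a b : {v | Fintype.equivFin V v = i},
      ¬ (D.induced {v | Fintype.equivFin V v = i}).Adj a b := by
    rintro ⟨a, ha⟩ ⟨b, hb⟩ hab
    have e : a = b := (Fintype.equivFin V).injective (ha.trans hb.symm)
    subst e
    exact hD a a hab hab
  obtain h | ⟨-, h⟩ := h
  · exact key _ _ h
  · exact key _ _ h

/-- The arcless digraph is oriented and triangle-free. -/
theorem bot_isOriented_isTriangleFree (V : Type*) :
    (⊥ : Digraph V).IsOriented ∧ (⊥ : Digraph V).IsTriangleFree := by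
  refine ⟨fun u v h => h.elim, ?_⟩
  unfold IsTriangleFree
  rw [toSimpleGraphInclusive_bot]
  exact SimpleGraph.cliqueFree_bot (by norm_num)

end Digraph

/-- `minAcyclicNumber n` is a minimum. -/
theorem minAcyclicNumber_isLeast (n : ℕ) :
    IsLeast {k : ℕ | ∃ D : Digraph (Fin n),
      D.IsOriented ∧ D.IsTriangleFree ∧ D.acyclicNumber = k} (minAcyclicNumber n) :=
  have h := Digraph.bot_isOriented_isTriangleFree (Fin n)
  ⟨Nat.sInf_mem ⟨_, ⊥, h.1, h.2, rfl⟩, fun _ hk => Nat.sInf_le hk⟩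

/-- `maxDichromaticNumber n` is a maximum. -/
theorem maxDichromaticNumber_isGreatest (n : ℕ) :
    IsGreatest {k : ℕ | ∃ D : Digraph (Fin n),
      D.IsOriented ∧ D.IsTriangleFree ∧ D.dichromaticNumber = k} (maxDichromaticNumber n) := by
  have h := Digraph.bot_isOriented_isTriangleFree (Fin n)
  have hb : BddAbove {k : ℕ | ∃ D : Digraph (Fin n),
      D.IsOriented ∧ D.IsTriangleFree ∧ D.dichromaticNumber = k} := by
    classical
    refine ((Set.finite_range fun D : Digraph (Fin n) => D.dichromaticNumber).subset ?_).bddAbove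
    rintro k ⟨D, -, -, rfl⟩
    exact ⟨D, rfl⟩
  exact ⟨Nat.sSup_mem ⟨_, ⊥, h.1, h.2, rfl⟩ hb, fun k hk => le_csSup hb hk⟩

/-! The proof is probabilistic, written as counting. Colour every unordered pair of vertices
uniformly with `m + 2` colours, where `m + 1` is about `5√n`: two colours encode the two
orientations, the others mean no arc. Delete all pairs of a maximal pairwise side-disjoint family of
triangles whose sides all carry arc colours; maximality makes the rest triangle-free.

A topological order of an acyclic set of size at least `3b` yields three `b`-blocks with no arc from
a later block to an earlier one, hence a set `Q` of `3b²` ordered pairs that are all non-arcs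
(`exists_three_blocks`). Each such pair either misses one prescribed colour or was deleted.
`card_covered_le` bounds the probability of this by summing over the deleted triangles that meet
`Q`: being disjoint, they constrain independent colours. At most `|Q| n` triangles meet `Q`, so the
gain of order `|Q|/(5√n)` in the exponent beats the loss `|Q| n (2/(5√n))³`, and a union bound over
block triples finishes (`exists_acyclicNumber_lt`, `union_bound_lt_one`). The dichromatic bound
follows from `n ≤ χ⃗ · α⃗`. -/

open Finset in
theorem exists_maximal_disjoint_family {E : Type*} [DecidableEq E] (𝒯 : Finset (Finset E))
    (p : Finset E → Prop) (h3 : ∀ T ∈ 𝒯, T.Nonempty) :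
    ∃ F ⊆ 𝒯, (∀ T ∈ F, p T) ∧ (F : Set (Finset E)).PairwiseDisjoint id ∧
      ∀ T ∈ 𝒯, p T → ∃ e ∈ T, e ∈ F.biUnion id := by
  classical
  obtain ⟨F, hF⟩ := (𝒯.powerset.filter fun F : Finset (Finset E) =>
    (∀ T ∈ F, p T) ∧ (F : Set (Finset E)).PairwiseDisjoint id).exists_maximal
      ⟨∅, by simp⟩
  have hmem := hF.prop
  simp only [mem_filter, mem_powerset] at hmem
  refine ⟨F, hmem.1, hmem.2.1, hmem.2.2, fun T hT hpT => ?_⟩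
  by_contra! hcon
  have hTF : T ∉ F := fun h => by
    obtain ⟨e, he⟩ := h3 T hT
    exact hcon e he (mem_biUnion.2 ⟨T, h, he⟩)
  have hle : insert T F ≤ F := by
    refine hF.le_of_ge ?_ (subset_insert _ _)
    simp only [mem_filter, mem_powerset]
    refine ⟨insert_subset hT hmem.1, ?_, ?_⟩
    · intro S hS
      rcases mem_insert.1 hS with rfl | hS
      exacts [hpT, hmem.2.1 S hS]
    · rw [coe_insert]
      refine hmem.2.2.insert fun S hS _ => ?_
      refine disjoint_left.2 ?_
      exact fun e he heS => hcon e he (mem_biUnion.2 ⟨S, hS, heS⟩)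
  exact hTF (hle (mem_insert_self _ _))

open Finset in
/-- The number of colourings such that every `e ∈ Q` of colour `a e` is covered by a disjoint
family of triples from `𝒯` whose elements all have colour `0` or `1`. -/
theorem card_covered_le {E : Type*} [Fintype E] [DecidableEq E] (m : ℕ)
    (𝒯 : Finset (Finset E)) (h3 : ∀ T ∈ 𝒯, T.card = 3)
    (F : (E → Fin (m + 2)) → Finset (Finset E)) (hF𝒯 : ∀ f, F f ⊆ 𝒯)
    (hFp : ∀ f, ∀ T ∈ F f, ∀ e ∈ T, f e = 0 ∨ f e = 1)
    (hFd : ∀ f, (F f : Set (Finset E)).PairwiseDisjoint id)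
    (Q : Finset E) (a : E → Fin (m + 2)) :
    ((univ.filter fun f : E → Fin (m + 2) =>
        ∀ e ∈ Q, f e = a e → e ∈ (F f).biUnion id).card : ℝ) ≤
      (m + 2 : ℝ) ^ Fintype.card E * (1 - 1 / (m + 2 : ℝ)) ^ Q.card *
        (1 + (2 / (m + 1 : ℝ)) ^ 3) ^ (𝒯.filter fun T => ¬ Disjoint T Q).card := by
  classical
  set 𝒯Q := 𝒯.filter fun T => ¬ Disjoint T Q with h𝒯Q
  -- Once the family `G` of chosen triples meeting `Q` is fixed, the constraints on different
  -- elements are independent, so the admissible colourings form a product set.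
  set box : Finset (Finset E) → Finset (E → Fin (m + 2)) := fun G =>
    Fintype.piFinset fun e => if e ∈ G.biUnion id then {0, 1} else
      if e ∈ Q then univ.erase (a e) else univ with hbox
  set 𝒢 := 𝒯Q.powerset.filter fun G : Finset (Finset E) => (G : Set (Finset E)).PairwiseDisjoint id with h𝒢
  have hcover : (univ.filter fun f : E → Fin (m + 2) =>
      ∀ e ∈ Q, f e = a e → e ∈ (F f).biUnion id) ⊆ 𝒢.biUnion box := by
    intro f hf
    simp only [mem_filter, mem_univ, true_and] at hf
    rw [mem_biUnion]
    refine ⟨(F f).filter fun T => ¬ Disjoint T Q, ?_, ?_⟩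
    · rw [h𝒢, mem_filter, mem_powerset]
      exact ⟨filter_subset_filter _ (hF𝒯 f), (hFd f).subset fun _ hT => (mem_filter.1 hT).1⟩
    · rw [hbox, Fintype.mem_piFinset]
      intro e
      split_ifs with h1 h2
      · obtain ⟨T, hT, he⟩ := mem_biUnion.1 h1
        have := hFp f T (mem_filter.1 hT).1 e he
        simpa using this
      · refine mem_erase.2 ⟨fun hfe => h1 ?_, mem_univ _⟩
        obtain ⟨T, hT, he⟩ := mem_biUnion.1 (hf e h2 hfe)
        exact mem_biUnion.2 ⟨T, mem_filter.2 ⟨hT, not_disjoint_iff.2 ⟨e, he, h2⟩⟩, he⟩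
      · exact mem_univ _
  have hm1 : (0 : ℝ) < m + 1 := by positivity
  have hm2 : (0 : ℝ) < m + 2 := by positivity
  have hq : 0 ≤ 1 - 1 / (m + 2 : ℝ) := by
    rw [sub_nonneg, div_le_one hm2]; linarith
  have hcard : ∀ G ∈ 𝒢, ((box G).card : ℝ) ≤
      (m + 2 : ℝ) ^ Fintype.card E * (1 - 1 / (m + 2 : ℝ)) ^ Q.card *
        ((2 / (m + 1 : ℝ)) ^ 3) ^ G.card := by
    intro G hG
    rw [h𝒢, mem_filter, mem_powerset] at hG
    have hU : (G.biUnion id).card = 3 * G.card := by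
      rw [card_biUnion hG.2, mul_comm]
      exact sum_const_nat fun T hT => h3 T (mem_filter.1 (hG.1 hT)).1
    rw [hbox, Fintype.card_piFinset, Nat.cast_prod, ← pow_mul, ← hU]
    -- The weight `2 / (m + 1)` is chosen so that a covered element of `Q` contributes exactly `2`;
    -- for a covered element outside `Q` it only overestimates.
    calc _ ≤ ∏ e : E, ((m + 2 : ℝ) * (if e ∈ Q then (1 - 1 / (m + 2 : ℝ)) else 1) *
            (if e ∈ G.biUnion id then 2 / (m + 1 : ℝ) else 1)) := by
          refine prod_le_prod (fun _ _ => Nat.cast_nonneg _) fun e _ => ?_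
          by_cases h1 : e ∈ G.biUnion id
          · rw [if_pos h1, if_pos h1]
            have h2 : (({0, 1} : Finset (Fin (m + 2))).card : ℝ) ≤ 2 := by
              exact_mod_cast card_le_two
            refine h2.trans ?_
            split_ifs
            · apply le_of_eq; field_simp; ring
            · rw [mul_one, mul_div_assoc', le_div_iff₀ hm1]; linarith
          · rw [if_neg h1, if_neg h1]
            split_ifs
            · rw [card_erase_of_mem (mem_univ _)]
              apply le_of_eq
              simp only [card_univ, Fintype.card_fin]
              field_simp
              push_cast
              ring
            · simp
      _ = _ := by
          rw [prod_mul_distrib, prod_mul_distrib, prod_const, card_univ, prod_ite_mem,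
            prod_ite_mem, univ_inter, univ_inter, prod_const, prod_const]
  calc _ ≤ ∑ G ∈ 𝒢, ((box G).card : ℝ) := by
        exact_mod_cast (card_le_card hcover).trans card_biUnion_le
    _ ≤ ∑ G ∈ 𝒢, (m + 2 : ℝ) ^ Fintype.card E * (1 - 1 / (m + 2 : ℝ)) ^ Q.card *
        ((2 / (m + 1 : ℝ)) ^ 3) ^ G.card := sum_le_sum hcard
    -- Disjointness was needed only for `|⋃ G| = 3 |G|`; dropping it now turns the sum into a
    -- binomial expansion.
    _ ≤ ∑ G ∈ 𝒯Q.powerset, (m + 2 : ℝ) ^ Fintype.card E * (1 - 1 / (m + 2 : ℝ)) ^ Q.card *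
        ((2 / (m + 1 : ℝ)) ^ 3) ^ G.card :=
      sum_le_sum_of_subset_of_nonneg (filter_subset _ _) fun _ _ _ => by positivity
    _ = _ := by
      rw [← mul_sum]
      congr 1
      have := sum_pow_mul_eq_add_pow ((2 / (m + 1 : ℝ)) ^ 3) 1 𝒯Q
      simp only [one_pow, mul_one] at this
      rw [this, add_comm]

/-! ### Triangles as triples of unordered pairs -/

section Triangles

variable {V : Type*} [DecidableEq V]

/-- The set of sides of a triangle. -/
def triangleSides (u v w : V) : Finset (Sym2 V) := {s(u, v), s(u, w), s(v, w)}

theorem card_triangleSides {u v w : V} (huv : u ≠ v) (huw : u ≠ w) (hvw : v ≠ w) :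
    (triangleSides u v w).card = 3 := by
  rw [triangleSides, Finset.card_eq_three]
  refine ⟨_, _, _, ?_, ?_, ?_, rfl⟩ <;> simp <;> tauto

theorem exists_triangleSides_eq {u v w x y : V} (h : s(x, y) ∈ triangleSides u v w) :
    ∃ z, triangleSides u v w = triangleSides x y z := by
  simp only [triangleSides, Finset.mem_insert, Finset.mem_singleton, Sym2.eq_iff] at h ⊢
  rcases h with (⟨rfl, rfl⟩ | ⟨rfl, rfl⟩) | (⟨rfl, rfl⟩ | ⟨rfl, rfl⟩) | (⟨rfl, rfl⟩ | ⟨rfl, rfl⟩)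
  · exact ⟨w, rfl⟩
  · refine ⟨w, ?_⟩
    ext e; simp only [Finset.mem_insert, Finset.mem_singleton, Sym2.eq_swap (a := x)]; tauto
  · refine ⟨v, ?_⟩
    ext e; simp only [Finset.mem_insert, Finset.mem_singleton, Sym2.eq_swap (a := v)]; tauto
  · refine ⟨v, ?_⟩
    ext e
    simp only [Finset.mem_insert, Finset.mem_singleton, Sym2.eq_swap (a := y) (b := v),
      Sym2.eq_swap (a := v) (b := x), Sym2.eq_swap (a := y) (b := x)]
    tauto
  · refine ⟨u, ?_⟩
    ext e
    simp only [Finset.mem_insert, Finset.mem_singleton, Sym2.eq_swap (a := u)]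
    tauto
  · refine ⟨u, ?_⟩
    ext e
    simp only [Finset.mem_insert, Finset.mem_singleton, Sym2.eq_swap (a := u),
      Sym2.eq_swap (a := y) (b := x)]
    tauto

variable (V) [Fintype V]

/-- The side sets of all triangles with vertices in `V`. -/
def allTriangleSides : Finset (Finset (Sym2 V)) :=
  (Finset.univ.filter fun t : V × V × V => t.1 ≠ t.2.1 ∧ t.1 ≠ t.2.2 ∧ t.2.1 ≠ t.2.2).image
    fun t => triangleSides t.1 t.2.1 t.2.2

variable {V}

theorem mem_allTriangleSides {T : Finset (Sym2 V)} : T ∈ allTriangleSides V ↔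
    ∃ u v w : V, (u ≠ v ∧ u ≠ w ∧ v ≠ w) ∧ triangleSides u v w = T := by
  simp [allTriangleSides]

theorem card_of_mem_allTriangleSides {T : Finset (Sym2 V)} (hT : T ∈ allTriangleSides V) :
    T.card = 3 := by
  obtain ⟨u, v, w, h, rfl⟩ := mem_allTriangleSides.1 hT
  exact card_triangleSides h.1 h.2.1 h.2.2

/-- A triangle is determined by one of its sides and the opposite vertex. -/
theorem card_triangles_meeting_le (Q : Finset (V × V)) :
    ((allTriangleSides V).filter fun T =>
      ¬ Disjoint T (Q.image fun p => s(p.1, p.2))).card ≤ Q.card * Fintype.card V := by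
  rw [← Finset.card_univ, ← Finset.card_product]
  refine (Finset.card_le_card ?_).trans
    (Finset.card_image_le (f := fun q : (V × V) × V => triangleSides q.1.1 q.1.2 q.2))
  intro T hT
  obtain ⟨hT, hd⟩ := Finset.mem_filter.1 hT
  obtain ⟨u, v, w, -, rfl⟩ := mem_allTriangleSides.1 hT
  obtain ⟨e, he, heQ⟩ := Finset.not_disjoint_iff.1 hd
  obtain ⟨⟨x, y⟩, hxy, rfl⟩ := Finset.mem_image.1 heQ
  obtain ⟨z, hz⟩ := exists_triangleSides_eq he
  exact Finset.mem_image.2 ⟨((x, y), z), by simp [hxy], hz.symm⟩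

end Triangles

/-! ### From colourings to oriented graphs -/

section ColourDigraph

variable {V : Type*} [LinearOrder V] {m : ℕ}

/-- The colour by which a pair of vertices becomes an arc from `u` to `v`. -/
def arcColour (m : ℕ) (u v : V) : Fin (m + 2) := if u < v then 0 else 1

/-- The digraph encoded by a colouring of the pairs of vertices, with the pairs in `U` deleted. -/
def colourDigraph (f : Sym2 V → Fin (m + 2)) (U : Finset (Sym2 V)) : Digraph V where
  Adj u v := u ≠ v ∧ f s(u, v) = arcColour m u v ∧ s(u, v) ∉ U

theorem arcColour_swap_ne {u v : V} (h : u ≠ v) : arcColour m u v ≠ arcColour m v u := by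
  rcases lt_or_gt_of_ne h with h | h <;> simp [arcColour, h, h.not_gt]

theorem colourDigraph_isOriented (f : Sym2 V → Fin (m + 2)) (U : Finset (Sym2 V)) :
    (colourDigraph f U).IsOriented := by
  rintro u v ⟨h, huv, -⟩ ⟨-, hvu, -⟩
  rw [Sym2.eq_swap] at hvu
  exact arcColour_swap_ne h (huv.symm.trans hvu)

theorem colourDigraph_isTriangleFree [Fintype V] (f : Sym2 V → Fin (m + 2)) (U : Finset (Sym2 V))
    (hU : ∀ T ∈ allTriangleSides V, (∀ e ∈ T, f e = 0 ∨ f e = 1) → ∃ e ∈ T, e ∈ U) :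
    (colourDigraph f U).IsTriangleFree := by
  have key : ∀ u v, (colourDigraph f U).toSimpleGraphInclusive.Adj u v →
      u ≠ v ∧ (f s(u, v) = 0 ∨ f s(u, v) = 1) ∧ s(u, v) ∉ U := by
    rintro u v ⟨hne, ⟨-, h, hU⟩ | ⟨-, h, hU⟩⟩
    · refine ⟨hne, ?_, hU⟩
      rw [h, arcColour]; split_ifs <;> simp
    · rw [Sym2.eq_swap] at h hU
      refine ⟨hne, ?_, hU⟩
      rw [h, arcColour]; split_ifs <;> simp
  intro t ht
  obtain ⟨u, v, w, huv, huw, hvw, -⟩ := SimpleGraph.is3Clique_iff.1 ht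
  have h1 := key _ _ huv
  have h2 := key _ _ huw
  have h3 := key _ _ hvw
  obtain ⟨e, he, heU⟩ := hU _ (mem_allTriangleSides.2 ⟨u, v, w, ⟨h1.1, h2.1, h3.1⟩, rfl⟩) (by
    simp only [triangleSides, Finset.mem_insert, Finset.mem_singleton]
    rintro e (rfl | rfl | rfl)
    exacts [h1.2.1, h2.2.1, h3.2.1])
  simp only [triangleSides, Finset.mem_insert, Finset.mem_singleton] at he
  rcases he with rfl | rfl | rfl
  exacts [h1.2.2 heU, h2.2.2 heU, h3.2.2 heU]

/-- On an antisymmetric set of ordered pairs the arc colours come from a single function on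
unordered pairs. -/
theorem exists_colour_eq_arcColour (m : ℕ) (Q : Finset (V × V))
    (hQ : ∀ u v, (u, v) ∈ Q → (v, u) ∉ Q) :
    ∃ a : Sym2 V → Fin (m + 2), ∀ u v, (u, v) ∈ Q → a s(u, v) = arcColour m u v := by
  classical
  refine ⟨fun e => if ∃ p ∈ Q, s(p.1, p.2) = e ∧ p.1 < p.2 then 0 else 1, fun u v huv => ?_⟩
  refine if_congr ⟨?_, ?_⟩ rfl rfl
  · rintro ⟨⟨x, y⟩, hxy, h, hlt⟩
    rcases Sym2.eq_iff.1 h with ⟨rfl, rfl⟩ | ⟨rfl, rfl⟩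
    · exact hlt
    · exact (hQ _ _ hxy huv).elim
  · exact fun h => ⟨(u, v), huv, rfl, h⟩

theorem card_image_sym2_of_antisymm (Q : Finset (V × V)) (hQ : ∀ u v, (u, v) ∈ Q → (v, u) ∉ Q) :
    (Q.image fun p => s(p.1, p.2)).card = Q.card := by
  refine Finset.card_image_of_injOn ?_
  rintro ⟨u, v⟩ h ⟨x, y⟩ h' he
  rcases Sym2.eq_iff.1 he with ⟨h1, h2⟩ | ⟨h1, h2⟩
  · simp only at h1 h2; rw [h1, h2]
  · simp only at h1 h2; subst h1 h2
    exact (hQ _ _ h h').elim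

end ColourDigraph

/-! ### Structure of acyclic sets -/

namespace Digraph

variable {V : Type*} {D : Digraph V}

theorem IsAcyclicSet.exists_source {S : Set V} (hS : D.IsAcyclicSet S) [Finite V]
    {R : Set V} (hR : R.Nonempty) (hRS : R ⊆ S) : ∃ x ∈ R, ∀ y ∈ R, ¬ D.Adj y x := by
  let r := Relation.TransGen (D.induced S).Adj
  have : IsTrans S r := ⟨fun _ _ _ => Relation.TransGen.trans⟩
  have : Std.Irrefl r := ⟨hS⟩
  obtain ⟨x₀, hx₀⟩ := hR
  obtain ⟨x, hx, hmin⟩ := (Finite.wellFounded_of_trans_of_irrefl r).has_min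
    {x | (x : V) ∈ R} ⟨⟨x₀, hRS hx₀⟩, hx₀⟩
  exact ⟨x, hx, fun y hy h => hmin ⟨y, hRS hy⟩ hy (.single h)⟩

/-- Removing sources one at a time builds an initial segment of a topological order. -/
theorem exists_initial_subset [DecidableEq V] {S : Finset V}
    (hS : ∀ R ⊆ S, R.Nonempty → ∃ x ∈ R, ∀ y ∈ R, ¬ D.Adj y x) (t : ℕ) (ht : t ≤ S.card) :
    ∃ A ⊆ S, A.card = t ∧ ∀ u ∈ S \ A, ∀ v ∈ A, ¬ D.Adj u v := by
  induction t with
  | zero => exact ⟨∅, by simp, rfl, by simp⟩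
  | succ t ih =>
    obtain ⟨A, hAS, hA, hadj⟩ := ih (by omega)
    have hne : (S \ A).Nonempty := by
      rw [← Finset.card_pos, Finset.card_sdiff_of_subset hAS]; omega
    obtain ⟨x, hx, hmin⟩ := hS _ Finset.sdiff_subset hne
    rw [Finset.mem_sdiff] at hx
    refine ⟨insert x A, Finset.insert_subset hx.1 hAS, by
      rw [Finset.card_insert_of_notMem hx.2, hA], fun u hu v hv => ?_⟩
    have hu' : u ∈ S \ A := by
      simp only [Finset.mem_sdiff, Finset.mem_insert, not_or] at hu ⊢
      tauto
    rcases Finset.mem_insert.1 hv with rfl | hv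
    exacts [hmin u hu', hadj u hu' v hv]

theorem IsAcyclicSet.exists_three_blocks [Finite V] [DecidableEq V] {S : Finset V}
    (hS : D.IsAcyclicSet (S : Set V)) {b : ℕ} (hb : 3 * b ≤ S.card) :
    ∃ A B C : Finset V, A.card = b ∧ B.card = b ∧ C.card = b ∧
      Disjoint A B ∧ Disjoint A C ∧ Disjoint B C ∧
      ∀ u v, (u, v) ∈ (B ∪ C) ×ˢ A ∪ C ×ˢ B → ¬ D.Adj u v := by
  have hS' : ∀ R ⊆ S, R.Nonempty → ∃ x ∈ R, ∀ y ∈ R, ¬ D.Adj y x := fun R hR hne => by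
    simpa using hS.exists_source (R := R) (by simpa using hne) (by simpa using hR)
  obtain ⟨A, hAS, hA, hadjA⟩ := exists_initial_subset hS' b (by omega)
  have hcard := Finset.card_sdiff_of_subset hAS
  obtain ⟨B, hBS, hB, hadjB⟩ := exists_initial_subset (D := D) (S := S \ A)
    (fun R hR => hS' R (hR.trans Finset.sdiff_subset)) b (by omega)
  have hcard' := Finset.card_sdiff_of_subset hBS
  obtain ⟨C, hCS, hC⟩ := Finset.exists_subset_card_eq (s := (S \ A) \ B) (n := b) (by omega)
  have hCA : C ⊆ S \ A := hCS.trans Finset.sdiff_subset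
  refine ⟨A, B, C, hA, hB, hC, (Finset.sdiff_disjoint.mono_left hBS).symm,
    (Finset.sdiff_disjoint.mono_left hCA).symm, (Finset.sdiff_disjoint.mono_left hCS).symm, ?_⟩
  intro u v h
  simp only [Finset.mem_union, Finset.mem_product] at h
  rcases h with ⟨hu | hu, hv⟩ | ⟨hu, hv⟩
  exacts [hadjA u (hBS hu) v hv, hadjA u (hCA hu) v hv, hadjB u (hCS hu) v hv]

theorem IsDicolourable.card_le_mul [Fintype V] {k : ℕ} (h : D.IsDicolourable k) :
    Fintype.card V ≤ k * D.acyclicNumber := by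
  classical
  obtain ⟨φ, hφ⟩ := h
  have := Finset.card_le_mul_card_image_of_maps_to (s := (Finset.univ : Finset V))
    (t := (Finset.univ : Finset (Fin k))) (f := φ) (fun _ _ => Finset.mem_univ _) D.acyclicNumber
    fun i _ => D.acyclicNumber_isGreatest.2 ⟨_, by simpa using hφ i, rfl⟩
  simpa [mul_comm] using this

end Digraph

/-! ### The union bound and its asymptotics -/

open Finset in
/-- If the union bound over triples of blocks succeeds, there is an oriented triangle-free graph
with small acyclic number. -/
theorem exists_acyclicNumber_lt (n b m : ℕ)
    (h : (n.choose b : ℝ) ^ 3 * ((1 - 1 / (m + 2 : ℝ)) ^ (3 * b ^ 2) *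
      (1 + (2 / (m + 1 : ℝ)) ^ 3) ^ (3 * b ^ 2 * n)) < 1) :
    ∃ D : Digraph (Fin n), D.IsOriented ∧ D.IsTriangleFree ∧ D.acyclicNumber < 3 * b := by
  classical
  have hex : ∀ f : Sym2 (Fin n) → Fin (m + 2), ∃ F ⊆ allTriangleSides (Fin n),
      (∀ T ∈ F, ∀ e ∈ T, f e = 0 ∨ f e = 1) ∧
      (F : Set (Finset (Sym2 (Fin n)))).PairwiseDisjoint id ∧
      ∀ T ∈ allTriangleSides (Fin n), (∀ e ∈ T, f e = 0 ∨ f e = 1) →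
        ∃ e ∈ T, e ∈ F.biUnion id := fun f =>
    exists_maximal_disjoint_family _ (fun T => ∀ e ∈ T, f e = 0 ∨ f e = 1) fun T hT =>
      card_pos.1 (by rw [card_of_mem_allTriangleSides hT]; norm_num)
  choose F hF𝒯 hFp hFd hFmax using hex
  set D : (Sym2 (Fin n) → Fin (m + 2)) → Digraph (Fin n) :=
    fun f => colourDigraph f ((F f).biUnion id) with hD
  set pairs : Finset (Fin n) × Finset (Fin n) × Finset (Fin n) → Finset (Fin n × Fin n) :=
    fun t => (t.2.1 ∪ t.2.2) ×ˢ t.1 ∪ t.2.2 ×ˢ t.2.1 with hpairs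
  set bad : Finset (Fin n) × Finset (Fin n) × Finset (Fin n) →
      Finset (Sym2 (Fin n) → Fin (m + 2)) := fun t =>
    univ.filter fun f => ∀ u v, (u, v) ∈ pairs t → ¬ (D f).Adj u v with hbad
  set P := powersetCard b (univ : Finset (Fin n)) with hP
  set 𝒮 := (P ×ˢ P ×ˢ P).filter fun t =>
    Disjoint t.1 t.2.1 ∧ Disjoint t.1 t.2.2 ∧ Disjoint t.2.1 t.2.2 with h𝒮
  have hbad_card : ∀ t ∈ 𝒮, ((bad t).card : ℝ) ≤
      (m + 2 : ℝ) ^ Fintype.card (Sym2 (Fin n)) * ((1 - 1 / (m + 2 : ℝ)) ^ (3 * b ^ 2) *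
        (1 + (2 / (m + 1 : ℝ)) ^ 3) ^ (3 * b ^ 2 * n)) := by
    rintro ⟨A, B, C⟩ ht
    simp only [h𝒮, hP, mem_filter, mem_product, mem_powersetCard_univ] at ht
    obtain ⟨⟨hA, hB, hC⟩, hAB, hAC, hBC⟩ := ht
    have hanti : ∀ u v, (u, v) ∈ pairs (A, B, C) → (v, u) ∉ pairs (A, B, C) := by
      intro u v
      simp only [hpairs, mem_union, mem_product]
      have h1 := fun x (h : x ∈ _) => disjoint_left.1 hAB h
      have h2 := fun x (h : x ∈ _) => disjoint_left.1 hAC h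
      have h3 := fun x (h : x ∈ _) => disjoint_left.1 hBC h
      have := h1 u; have := h1 v; have := h2 u; have := h2 v; have := h3 u; have := h3 v
      tauto
    have hQcard : (pairs (A, B, C)).card = 3 * b ^ 2 := by
      have hd : Disjoint ((B ∪ C) ×ˢ A) (C ×ˢ B) :=
        disjoint_product.2 (Or.inr hAB)
      rw [hpairs, card_union_of_disjoint hd, card_product, card_product,
        card_union_of_disjoint hBC, hA, hB, hC]
      ring
    obtain ⟨a, ha⟩ := exists_colour_eq_arcColour m _ hanti
    have hle := card_covered_le m (allTriangleSides (Fin n))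
      (fun T => card_of_mem_allTriangleSides) F hF𝒯 hFp hFd
      ((pairs (A, B, C)).image fun p => s(p.1, p.2)) a
    rw [card_image_sym2_of_antisymm _ hanti, hQcard] at hle
    have hT := card_triangles_meeting_le (pairs (A, B, C))
    rw [hQcard, Fintype.card_fin] at hT
    have hsub : bad (A, B, C) ⊆ univ.filter fun f : Sym2 (Fin n) → Fin (m + 2) =>
        ∀ e ∈ (pairs (A, B, C)).image fun p => s(p.1, p.2),
          f e = a e → e ∈ (F f).biUnion id := by
      intro f hf
      simp only [hbad, mem_filter, mem_univ, true_and] at hf ⊢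
      intro e he hfe
      obtain ⟨⟨u, v⟩, huv, rfl⟩ := mem_image.1 he
      by_contra hU
      refine hf u v huv ⟨?_, hfe.trans (ha u v huv), hU⟩
      rintro rfl
      exact hanti _ _ huv huv
    have hq : 0 ≤ 1 - 1 / (m + 2 : ℝ) := by
      rw [sub_nonneg, div_le_one (by positivity)]
      linarith [(Nat.cast_nonneg m : (0 : ℝ) ≤ m)]
    refine (Nat.cast_le.2 (card_le_card hsub)).trans (hle.trans ?_)
    rw [mul_assoc]
    gcongr
    exact le_add_of_nonneg_right (by positivity)
  have hlt : (𝒮.biUnion bad).card < (univ : Finset (Sym2 (Fin n) → Fin (m + 2))).card := by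
    rw [← Nat.cast_lt (α := ℝ)]
    have hPcard : P.card = n.choose b := by rw [hP, card_powersetCard, card_fin]
    have h𝒮card : (𝒮.card : ℝ) ≤ (n.choose b : ℝ) ^ 3 := by
      have : 𝒮.card ≤ n.choose b ^ 3 := (card_filter_le _ _).trans (by
        rw [card_product, card_product, hPcard]; apply le_of_eq; ring)
      exact_mod_cast this
    have hq : 0 ≤ 1 - 1 / (m + 2 : ℝ) := by
      rw [sub_nonneg, div_le_one (by positivity)]
      linarith [(Nat.cast_nonneg m : (0 : ℝ) ≤ m)]
    calc ((𝒮.biUnion bad).card : ℝ) ≤ ∑ t ∈ 𝒮, ((bad t).card : ℝ) := by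
          exact_mod_cast card_biUnion_le
      _ ≤ 𝒮.card • ((m + 2 : ℝ) ^ Fintype.card (Sym2 (Fin n)) *
          ((1 - 1 / (m + 2 : ℝ)) ^ (3 * b ^ 2) *
            (1 + (2 / (m + 1 : ℝ)) ^ 3) ^ (3 * b ^ 2 * n))) := sum_le_card_nsmul _ _ _ hbad_card
      _ ≤ (n.choose b : ℝ) ^ 3 * ((m + 2 : ℝ) ^ Fintype.card (Sym2 (Fin n)) *
          ((1 - 1 / (m + 2 : ℝ)) ^ (3 * b ^ 2) *
            (1 + (2 / (m + 1 : ℝ)) ^ 3) ^ (3 * b ^ 2 * n))) := by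
          rw [nsmul_eq_mul]; gcongr
      _ = (m + 2 : ℝ) ^ Fintype.card (Sym2 (Fin n)) * ((n.choose b : ℝ) ^ 3 *
          ((1 - 1 / (m + 2 : ℝ)) ^ (3 * b ^ 2) *
            (1 + (2 / (m + 1 : ℝ)) ^ 3) ^ (3 * b ^ 2 * n))) := by ring
      _ < (m + 2 : ℝ) ^ Fintype.card (Sym2 (Fin n)) * 1 := by gcongr
      _ = _ := by simp
  obtain ⟨f, -, hf⟩ := exists_mem_notMem_of_card_lt_card hlt
  refine ⟨D f, colourDigraph_isOriented _ _, colourDigraph_isTriangleFree _ _ (hFmax f), ?_⟩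
  by_contra! hge
  obtain ⟨S, hS, hScard⟩ := (D f).acyclicNumber_isGreatest.1
  obtain ⟨A, B, C, hA, hB, hC, hAB, hAC, hBC, hadj⟩ :=
    hS.exists_three_blocks (b := b) (by omega)
  refine hf (mem_biUnion.2 ⟨(A, B, C), ?_, ?_⟩)
  · simp [h𝒮, hP, hA, hB, hC, hAB, hAC, hBC]
  · exact mem_filter.2 ⟨mem_univ _, hadj⟩

/-- This is the estimate `(n choose b) ≤ (e n / b)^b`, a consequence of `b^b / b! ≤ e^b`. -/
theorem choose_le_pow_of_exp_mul_le {n b : ℕ} {s : ℝ} (hb : 0 < b)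
    (h : Real.exp 1 * n ≤ s * b) : (n.choose b : ℝ) ≤ s ^ b := by
  have h1 := Nat.choose_le_pow_div (α := ℝ) b n
  have h2 := Real.pow_div_factorial_le_exp (x := b) (Nat.cast_nonneg b) b
  have hb' : (0 : ℝ) < (b : ℝ) ^ b := by positivity
  have hf : (0 : ℝ) < (b.factorial : ℝ) := by positivity
  have h3 : (n : ℝ) ^ b / b.factorial * (b : ℝ) ^ b ≤ s ^ b * (b : ℝ) ^ b := by
    calc (n : ℝ) ^ b / b.factorial * (b : ℝ) ^ b
        = (n : ℝ) ^ b * ((b : ℝ) ^ b / b.factorial) := by ring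
      _ ≤ (n : ℝ) ^ b * Real.exp b := by gcongr
      _ = (Real.exp 1 * n) ^ b := by
          rw [mul_pow, ← Real.exp_nat_mul, mul_one, mul_comm]
      _ ≤ (s * b) ^ b := by gcongr
      _ = _ := mul_pow _ _ _
  exact h1.trans (le_of_mul_le_mul_right h3 hb')

/-- With `r = √n`, the union bound succeeds for large `n`. -/
theorem union_bound_lt_one {n b m : ℕ} {r : ℝ} (hr : 1000 ≤ r) (hn : (n : ℝ) = r ^ 2)
    (hm1 : 5 * r ≤ m + 1) (hm2 : m + 1 ≤ 5 * r + 1) (hb : 4.4 * r * Real.log n ≤ b)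
    (hlog : 1 ≤ Real.log n) :
    (n.choose b : ℝ) ^ 3 * ((1 - 1 / (m + 2 : ℝ)) ^ (3 * b ^ 2) *
      (1 + (2 / (m + 1 : ℝ)) ^ 3) ^ (3 * b ^ 2 * n)) < 1 := by
  have hr0 : 0 < r := by linarith
  have hbr : 4.4 * r ≤ b := by nlinarith
  have hb0 : (0 : ℝ) < b := by linarith
  have hbpos : 0 < b := by exact_mod_cast hb0
  have hlogr : Real.log n = 2 * Real.log r := by rw [hn, Real.log_pow]; norm_num
  have hchoose : (n.choose b : ℝ) ≤ Real.exp (b * Real.log r) := by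
    rw [Real.exp_nat_mul, Real.exp_log hr0]
    refine choose_le_pow_of_exp_mul_le hbpos ?_
    rw [hn]
    nlinarith [Real.exp_one_lt_d9]
  have hm0 : (0 : ℝ) ≤ m := Nat.cast_nonneg m
  -- With `1 / (m + 2) ≈ c / r`, the net gain per pair is about `(c - 8c³) / r`, maximal at `c =
  -- 1/√24`; `c = 1/5` is close to that. The value `0.199` absorbs the rounding of `m`.
  have hq : 1 - 1 / (m + 2 : ℝ) ≤ Real.exp (-(0.199 / r)) := by
    refine le_trans ?_ (Real.one_sub_le_exp_neg _)
    have : 0.199 / r ≤ 1 / (m + 2 : ℝ) := by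
      rw [div_le_div_iff₀ hr0 (by positivity)]; linarith
    linarith
  have hq0 : 0 ≤ 1 - 1 / (m + 2 : ℝ) := by
    rw [sub_nonneg, div_le_one (by positivity)]; linarith
  have hx : 1 + (2 / (m + 1 : ℝ)) ^ 3 ≤ Real.exp (0.064 / r ^ 3) := by
    have h1 : (2 / (m + 1 : ℝ)) ^ 3 ≤ (2 / (5 * r)) ^ 3 := by gcongr
    have h2 : (2 / (5 * r)) ^ 3 = 0.064 / r ^ 3 := by field_simp; norm_num
    linarith [Real.add_one_le_exp (0.064 / r ^ 3)]
  calc _ ≤ Real.exp (b * Real.log r) ^ 3 * (Real.exp (-(0.199 / r)) ^ (3 * b ^ 2) *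
        Real.exp (0.064 / r ^ 3) ^ (3 * b ^ 2 * n)) := by gcongr
    -- Here `0.135 = 0.199 - 0.064`. The exponent is negative since `0.135 · 4.4 · log n = 1.188 log
    -- r`.
    _ = Real.exp (3 * b * (Real.log r - 0.135 * b / r)) := by
        rw [← Real.exp_nat_mul, ← Real.exp_nat_mul, ← Real.exp_nat_mul, ← Real.exp_add,
          ← Real.exp_add]
        congr 1
        push_cast
        rw [hn]
        field_simp
        ring
    _ < 1 := by
        rw [Real.exp_lt_one_iff]
        refine mul_neg_of_pos_of_neg (by positivity) ?_
        rw [sub_neg, lt_div_iff₀ hr0]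
        nlinarith

theorem eventually_exists_acyclicNumber_le : ∀ᶠ n : ℕ in atTop,
    ∃ D : Digraph (Fin n), D.IsOriented ∧ D.IsTriangleFree ∧
      (D.acyclicNumber : ℝ) ≤ 107 / 8 * Real.sqrt n * Real.log n := by
  have h1 : ∀ᶠ n : ℕ in atTop, 1 ≤ Real.log n :=
    (Real.tendsto_log_atTop.comp tendsto_natCast_atTop_atTop).eventually_ge_atTop 1
  filter_upwards [h1, eventually_ge_atTop (1000 ^ 2)] with n hlog hn
  set r := Real.sqrt n with hr
  have hr1 : 1000 ≤ r := Real.le_sqrt_of_sq_le (by exact_mod_cast hn)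
  have hnr : (n : ℝ) = r ^ 2 := (Real.sq_sqrt (Nat.cast_nonneg n)).symm
  have hL : 1000 ≤ r * Real.log n := by nlinarith
  -- Three blocks of size `107/24 · r log n` give the constant `107/8`; the excess of `107/24` over
  -- `4.4` pays for the floor.
  obtain ⟨D, hD, hT, hlt⟩ := exists_acyclicNumber_lt n ⌊107 / 24 * (r * Real.log n)⌋₊
    (⌈5 * r⌉₊ - 1) (by
      have hc : 1 ≤ ⌈5 * r⌉₊ := Nat.one_le_ceil_iff.2 (by linarith)
      refine union_bound_lt_one hr1 hnr ?_ ?_ ?_ hlog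
      · push_cast [hc]; linarith [Nat.le_ceil (5 * r)]
      · push_cast [hc]; linarith [Nat.ceil_lt_add_one (a := 5 * r) (by linarith)]
      · linarith [Nat.lt_floor_add_one (107 / 24 * (r * Real.log n))])
  refine ⟨D, hD, hT, ?_⟩
  have hfl := Nat.floor_le (a := 107 / 24 * (r * Real.log n)) (by linarith)
  have : (D.acyclicNumber : ℝ) ≤ 3 * (⌊107 / 24 * (r * Real.log n)⌋₊ : ℝ) := by
    exact_mod_cast hlt.le
  linarith

theorem mainTheorem2 :
    ∀ᶠ n : ℕ in atTop,
      (∃ D : Digraph (Fin n), D.IsOriented ∧ D.IsTriangleFree ∧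
        (D.acyclicNumber : ℝ) ≤ 107 / 8 * Real.sqrt n * Real.log n) ∧
      (minAcyclicNumber n : ℝ) ≤ 107 / 8 * Real.sqrt n * Real.log n ∧
      8 / 107 * (Real.sqrt n / Real.log n) ≤ (maxDichromaticNumber n : ℝ) := by
  filter_upwards [eventually_exists_acyclicNumber_le, eventually_gt_atTop 1] with n hex hn
  refine ⟨hex, ?_⟩
  obtain ⟨D, hD, hT, hle⟩ := hex
  constructor
  · exact (Nat.cast_le.2 ((minAcyclicNumber_isLeast n).2 ⟨D, hD, hT, rfl⟩)).trans hle
  · refine le_trans ?_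
      (Nat.cast_le.2 ((maxDichromaticNumber_isGreatest n).2 ⟨D, hD, hT, rfl⟩))
    have hlog : 0 < Real.log n := Real.log_pos (by exact_mod_cast hn)
    have hs : 0 < Real.sqrt n := Real.sqrt_pos.2 (by exact_mod_cast (by omega : 0 < n))
    have hmul : (n : ℝ) ≤ D.dichromaticNumber * D.acyclicNumber := by
      have := (D.dichromaticNumber_isLeast hD).1.card_le_mul
      rw [Fintype.card_fin] at this
      exact_mod_cast this
    have hmul' : (n : ℝ) ≤ D.dichromaticNumber * (107 / 8 * Real.sqrt n * Real.log n) :=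
      hmul.trans (by gcongr)
    have hsq : Real.sqrt n * Real.sqrt n = n := Real.mul_self_sqrt (Nat.cast_nonneg n)
    have h1 : Real.sqrt n ≤ D.dichromaticNumber * (107 / 8 * Real.log n) := by
      refine le_of_mul_le_mul_right ?_ hs
      rw [hsq]
      linarith
    rw [← mul_div_assoc, div_le_iff₀ hlog]
    linarith
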